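/- Let $k$ be a field (of arbitrary characteristic). Let $T$ be the diagonal torus in $\mathrm{SL}_2$ over $k$, and let $N(T)$ be the normalizer of $T$ in $\mathrm{SL}_2$, a linear algebraic group over $k$. Then $N(T)$ has no good representation: if $V$ is a finite-dimensional ($k$-rational) representation of $N(T)$, then there is no non-empty $N(T)$-invariant open subscheme $U$ of $V$ (regarded as an affine space over $k$) such that (i) $V \smallsetminus U$ is the union of finitely many $N(T)$-invariant $k$-linear subspaces of $V$, and (ii) $N(T)$ acts properly on $U$, that is, the morphism $N(T)\times_k U \to U\times_k U$, $(g,v)\mapsto (v, g v)$, is a proper morphism of schemes. -/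

import Mathlib

open CategoryTheory CategoryTheory.Limits AlgebraicGeometry
open scoped TensorProduct MatrixGroups

universe u

noncomputable section

namespace NormalizerTorus

/-! ### The normalizer of the diagonal torus of `SL₂` -/

/-- The `R`-points of the diagonal torus `T` of `SL₂`. -/
def torus (R : Type u) [CommRing R] : Subgroup SL(2, R) where
  carrier := {g | g 0 1 = 0 ∧ g 1 0 = 0}
  one_mem' := by simp
  mul_mem' := by
    rintro a b ⟨ha, ha'⟩ ⟨hb, hb'⟩
    simp [Matrix.mul_apply, ha, ha', hb, hb']
  inv_mem' := by
    rintro a ⟨ha, ha'⟩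
    simp [Matrix.SpecialLinearGroup.coe_inv, Matrix.adjugate_fin_two, ha, ha']

/-- The `R`-points of the normalizer `N(T)` (as a group functor): those `g ∈ SL₂(R)` whose image in
`SL₂(S)` normalizes `T(S)`, for every `R`-algebra `S`. -/
def normalizer (R : Type u) [CommRing R] : Subgroup SL(2, R) :=
  ⨅ (S : CommRingCat.{u}) (f : R →+* S),
    (Subgroup.normalizer (torus S : Set SL(2, S))).comap (Matrix.SpecialLinearGroup.map f)

/-- Functoriality of `N(T)`. -/
def normalizerMap {R S : Type u} [CommRing R] [CommRing S] (f : R →+* S) :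
    normalizer R →* normalizer S :=
  ((Matrix.SpecialLinearGroup.map f).comp (normalizer R).subtype).codRestrict (normalizer S) (by
    rintro ⟨g, hg⟩
    simp only [normalizer, Subgroup.mem_iInf, Subgroup.mem_comap] at hg ⊢
    intro A h
    exact hg A (h.comp f))

lemma conj_mem_torus_iff {R : Type u} [CommRing R] (g t : SL(2, R)) (ht : t ∈ torus R) :
    g * t * g⁻¹ ∈ torus R ↔
      g 0 0 * g 0 1 * (t 1 1 - t 0 0) = 0 ∧ g 1 0 * g 1 1 * (t 0 0 - t 1 1) = 0 := by
  obtain ⟨h1, h2⟩ := ht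
  have e1 : (g * t * g⁻¹) 0 1 = g 0 0 * g 0 1 * (t 1 1 - t 0 0) := by
    simp [Matrix.SpecialLinearGroup.coe_mul, Matrix.SpecialLinearGroup.coe_inv,
      Matrix.adjugate_fin_two, Matrix.mul_apply, Fin.sum_univ_two, h1, h2]
    ring
  have e2 : (g * t * g⁻¹) 1 0 = g 1 0 * g 1 1 * (t 0 0 - t 1 1) := by
    simp [Matrix.SpecialLinearGroup.coe_mul, Matrix.SpecialLinearGroup.coe_inv,
      Matrix.adjugate_fin_two, Matrix.mul_apply, Fin.sum_univ_two, h1, h2]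
    ring
  rw [← e1, ← e2]
  rfl

/-- The normalizer is the closed subgroup of `SL₂` cut out by `g₀₀ g₀₁ = 0` and `g₁₀ g₁₁ = 0`. -/
lemma mem_normalizer_iff {R : Type u} [CommRing R] (g : SL(2, R)) :
    g ∈ normalizer R ↔ g 0 0 * g 0 1 = 0 ∧ g 1 0 * g 1 1 = 0 := by
  constructor
  · intro hg
    simp only [normalizer, Subgroup.mem_iInf, Subgroup.mem_comap] at hg
    have h := hg (.of (LaurentPolynomial R)) LaurentPolynomial.C
    have hdet : Matrix.det !![(LaurentPolynomial.T 1 : LaurentPolynomial R), 0;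
        0, LaurentPolynomial.T (-1)] = 1 := by
      rw [Matrix.det_fin_two_of, ← LaurentPolynomial.T_add]
      simp
    have hT : (⟨_, hdet⟩ : SL(2, LaurentPolynomial R)) ∈ torus (LaurentPolynomial R) :=
      ⟨by simp, by simp⟩
    have h1 := (conj_mem_torus_iff _ _ hT).1 ((Subgroup.mem_normalizer_iff.1 h ⟨_, hdet⟩).1 hT)
    have key : ∀ r : R, LaurentPolynomial.C r * (LaurentPolynomial.T 1 : LaurentPolynomial R)
        = LaurentPolynomial.C r * LaurentPolynomial.T (-1) → r = 0 := by
      intro r hr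
      rw [← LaurentPolynomial.single_eq_C_mul_T, ← LaurentPolynomial.single_eq_C_mul_T] at hr
      have h0 : (AddMonoidAlgebra.single (1 : ℤ) r : LaurentPolynomial R).coeff 1
          = (AddMonoidAlgebra.single (-1 : ℤ) r : LaurentPolynomial R).coeff 1 := by rw [hr]
      rw [AddMonoidAlgebra.coeff_single, AddMonoidAlgebra.coeff_single] at h0
      simpa [Finsupp.single_apply] using h0
    obtain ⟨ha, hb⟩ := h1
    simp only [Matrix.SpecialLinearGroup.map_apply_coe, RingHom.mapMatrix_apply,
      Matrix.map_apply, Matrix.of_apply, Matrix.cons_val', Matrix.cons_val_zero,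
      Matrix.cons_val_one, Matrix.cons_val_fin_one] at ha hb
    constructor
    · apply key
      rw [map_mul]
      linear_combination -ha
    · apply key
      rw [map_mul]
      linear_combination hb
  · rintro ⟨h1, h2⟩
    simp only [normalizer, Subgroup.mem_iInf, Subgroup.mem_comap]
    intro S f
    have hd : g 0 0 * g 1 1 - g 0 1 * g 1 0 = 1 := by
      have := g.det_coe; rwa [Matrix.det_fin_two] at this
    have h3 : g 1 1 * g 0 1 = 0 := by
      linear_combination -(g 1 1 * g 0 1) * hd + g 1 1 ^ 2 * h1 - g 0 1 ^ 2 * h2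
    have h4 : g 1 0 * g 0 0 = 0 := by
      linear_combination -(g 1 0 * g 0 0) * hd + g 0 0 ^ 2 * h2 - g 1 0 ^ 2 * h1
    replace h1 := congrArg f h1
    replace h2 := congrArg f h2
    replace h3 := congrArg f h3
    replace h4 := congrArg f h4
    rw [map_mul, map_zero] at h1 h2 h3 h4
    rw [Subgroup.mem_normalizer_iff]
    intro t
    constructor
    · intro ht
      refine (conj_mem_torus_iff _ _ ht).2 ⟨?_, ?_⟩
      · simp [h1]
      · simp [h2]
    · intro ht
      have h := (conj_mem_torus_iff (Matrix.SpecialLinearGroup.map f g)⁻¹ _ ht).2 ⟨?_, ?_⟩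
      · convert h using 1
        group
      · simp [Matrix.SpecialLinearGroup.coe_inv, Matrix.adjugate_fin_two, h3]
      · simp [Matrix.SpecialLinearGroup.coe_inv, Matrix.adjugate_fin_two, h4]

/-! ### `N(T)` as an affine `k`-scheme -/

section Group

variable (k : Type u) [Field k]

/-- The ideal of `N(T)` in `k[x₀₀, x₀₁, x₁₀, x₁₁]`. -/
def coordIdeal : Ideal (MvPolynomial (Fin 2 × Fin 2) k) :=
  Ideal.span {MvPolynomial.X (0, 0) * MvPolynomial.X (1, 1) -
      MvPolynomial.X (0, 1) * MvPolynomial.X (1, 0) - 1,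
    MvPolynomial.X (0, 0) * MvPolynomial.X (0, 1),
    MvPolynomial.X (1, 0) * MvPolynomial.X (1, 1)}

/-- The coordinate ring `k[N(T)]`. -/
abbrev CoordRing : Type u := MvPolynomial (Fin 2 × Fin 2) k ⧸ coordIdeal k

/-- The matrix entries, as functions on `N(T)`. -/
def coordFn (i j : Fin 2) : CoordRing k := Ideal.Quotient.mk _ (MvPolynomial.X (i, j))

lemma coordFn_det :
    coordFn k 0 0 * coordFn k 1 1 - coordFn k 0 1 * coordFn k 1 0 = 1 := by
  rw [← sub_eq_zero]
  simp only [coordFn, ← map_mul, ← map_sub, ← map_one (Ideal.Quotient.mk (coordIdeal k))]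
  exact Ideal.Quotient.eq_zero_iff_mem.2 (Ideal.subset_span (by simp))

lemma coordFn_row_zero : coordFn k 0 0 * coordFn k 0 1 = 0 := by
  simp only [coordFn, ← map_mul]
  exact Ideal.Quotient.eq_zero_iff_mem.2 (Ideal.subset_span (by simp))

lemma coordFn_row_one : coordFn k 1 0 * coordFn k 1 1 = 0 := by
  simp only [coordFn, ← map_mul]
  exact Ideal.Quotient.eq_zero_iff_mem.2 (Ideal.subset_span (by simp))

/-- The universal point of `N(T)`, with values in `k[N(T)]`. -/
def universalElement : normalizer (CoordRing k) :=
  ⟨⟨Matrix.of (coordFn k), (Matrix.det_fin_two _).trans (coordFn_det k)⟩,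
    (mem_normalizer_iff _).2 ⟨coordFn_row_zero k, coordFn_row_one k⟩⟩

/-- `k[N(T)]` represents the functor `N(T)` on `k`-algebras. -/
theorem universalElement_bijective (R : Type u) [CommRing R] [Algebra k R] :
    Function.Bijective fun f : CoordRing k →ₐ[k] R =>
      normalizerMap (f : CoordRing k →+* R) (universalElement k) := by
  constructor
  · intro f f' h
    refine Ideal.Quotient.algHom_ext _ (MvPolynomial.algHom_ext fun p => ?_)
    exact congrArg (fun g : normalizer R => (g : SL(2, R)) p.1 p.2) h
  · rintro ⟨g, hg⟩
    obtain ⟨h1, h2⟩ := (mem_normalizer_iff g).1 hg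
    have hd : g 0 0 * g 1 1 - g 0 1 * g 1 0 = 1 := by
      have := g.det_coe; rwa [Matrix.det_fin_two] at this
    have h : ∀ a ∈ coordIdeal k, MvPolynomial.aeval (fun p : Fin 2 × Fin 2 => g p.1 p.2) a = 0 := by
      have hle : coordIdeal k ≤
          RingHom.ker (MvPolynomial.aeval (R := k) fun p : Fin 2 × Fin 2 => g p.1 p.2) := by
        refine Ideal.span_le.2 ?_
        rintro x (rfl | rfl | rfl)
        · simp [RingHom.mem_ker, hd]
        · simp [RingHom.mem_ker, h1]
        · simp [RingHom.mem_ker, h2]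
      exact fun a ha => hle ha
    refine ⟨Ideal.Quotient.liftₐ _ _ h, ?_⟩
    apply Subtype.ext
    ext i j
    change Ideal.Quotient.liftₐ _ _ h (Ideal.Quotient.mk _ (MvPolynomial.X (i, j))) = g i j
    exact (Ideal.Quotient.lift_mk _ _ _).trans (by simp)

/-- The group scheme `N(T)` over `k`, as a scheme. -/
abbrev groupScheme : Scheme.{u} := Spec (.of (CoordRing k))

/-- The structure morphism of `N(T)`. -/
def groupStr : groupScheme k ⟶ Spec (.of k) :=
  Spec.map (CommRingCat.ofHom (algebraMap k (CoordRing k)))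

end Group

/-! ### A vector space as an affine space over `k` -/

section VectorSpace

variable (k : Type u) [Field k] (V : Type u) [AddCommGroup V] [Module k V]

/-- The ring of polynomial functions on `V`. -/
abbrev PolyRing : Type u := SymmetricAlgebra k (Module.Dual k V)

/-- The affine space over `k` underlying `V`. -/
abbrev vecScheme : Scheme.{u} := Spec (.of (PolyRing k V))

/-- The structure morphism of the affine space `V`. -/
def vecStr : vecScheme k V ⟶ Spec (.of k) :=
  Spec.map (CommRingCat.ofHom (algebraMap k (PolyRing k V)))

variable {k V}

/-- The `R`-valued point of the affine space `V` given by `x ∈ R ⊗ V`, as an algebra map: a linear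
form `φ` on `V`, seen as a function on the affine space, takes the value `φ(x)`. -/
def vecPoint {R : Type u} [CommRing R] [Algebra k R] (x : R ⊗[k] V) : PolyRing k V →ₐ[k] R :=
  SymmetricAlgebra.lift
    { toFun := fun φ => Module.Dual.baseChange R φ x
      map_add' := fun φ ψ => by simp
      map_smul' := fun c φ => by simp }

/-- The linear subspace `L` of `V` as a closed subset of the affine space `V`. -/
def subspaceLocus (L : Submodule k V) : Set (vecScheme k V) :=
  PrimeSpectrum.zeroLocus (SymmetricAlgebra.ι k (Module.Dual k V) '' L.dualAnnihilator)

variable (k V) in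
/-- The universal vector `∑ bᵢ* ⊗ bᵢ`, with values in the ring of functions on `V`. -/
def universalVector [FiniteDimensional k V] : PolyRing k V ⊗[k] V :=
  ∑ i, SymmetricAlgebra.ι k (Module.Dual k V) ((Module.finBasis k V).coord i) ⊗ₜ[k]
    Module.finBasis k V i

lemma vecPoint_ι {R : Type u} [CommRing R] [Algebra k R] (x : R ⊗[k] V) (φ : Module.Dual k V) :
    vecPoint x (SymmetricAlgebra.ι k _ φ) = Module.Dual.baseChange R φ x := by
  simp [vecPoint]

lemma baseChange_rTensor {R S : Type u} [CommRing R] [Algebra k R] [CommRing S] [Algebra k S]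
    (f : R →ₐ[k] S) (φ : Module.Dual k V) (x : R ⊗[k] V) :
    Module.Dual.baseChange S φ (f.toLinearMap.rTensor V x) = f (Module.Dual.baseChange R φ x) := by
  induction x with
  | zero => simp
  | add x y hx hy => simp only [map_add, hx, hy]
  | tmul r v => simp

lemma rTensor_universalVector [FiniteDimensional k V] {R : Type u} [CommRing R] [Algebra k R]
    (x : R ⊗[k] V) :
    (vecPoint x).toLinearMap.rTensor V (universalVector k V) = x := by
  simp only [universalVector, map_sum, LinearMap.rTensor_tmul, AlgHom.toLinearMap_apply, vecPoint_ι]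
  induction x with
  | zero => simp
  | add x y hx hy =>
    simp only [map_add, TensorProduct.add_tmul, Finset.sum_add_distrib, hx, hy]
  | tmul r v =>
    conv_rhs => rw [← (Module.finBasis k V).sum_repr v]
    rw [TensorProduct.tmul_sum]
    simp [TensorProduct.smul_tmul']

lemma baseChange_universalVector [FiniteDimensional k V] (φ : Module.Dual k V) :
    Module.Dual.baseChange _ φ (universalVector k V) = SymmetricAlgebra.ι k _ φ := by
  conv_rhs => rw [← (Module.finBasis k V).sum_dual_apply_smul_coord φ]
  rw [map_sum]
  simp [universalVector, map_sum]

/-- The affine space `V` represents the functor `R ↦ R ⊗ V`. -/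
theorem universalVector_bijective [FiniteDimensional k V] (R : Type u) [CommRing R] [Algebra k R] :
    Function.Bijective fun f : PolyRing k V →ₐ[k] R =>
      f.toLinearMap.rTensor V (universalVector k V) := by
  refine ⟨fun f f' h => ?_, fun x => ⟨vecPoint x, rTensor_universalVector x⟩⟩
  refine SymmetricAlgebra.algHom_ext (LinearMap.ext fun φ => ?_)
  have := congrArg (Module.Dual.baseChange R φ) h
  simpa [baseChange_rTensor, baseChange_universalVector] using this

end VectorSpace

/-! ### The product `N(T) × V` -/

section Product

variable (k : Type u) [Field k] (V : Type u) [AddCommGroup V] [Module k V]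

/-- The coordinate ring of `N(T) × V`. -/
def ProdRing : Type u := CoordRing k ⊗[k] PolyRing k V

instance : CommRing (ProdRing k V) := inferInstanceAs (CommRing (CoordRing k ⊗[k] PolyRing k V))

instance : Algebra k (ProdRing k V) := inferInstanceAs (Algebra k (CoordRing k ⊗[k] PolyRing k V))

/-- The comorphism of the projection `N(T) × V → N(T)`. -/
def inclGroup : CoordRing k →ₐ[k] ProdRing k V :=
  (Algebra.TensorProduct.includeLeft : CoordRing k →ₐ[k] CoordRing k ⊗[k] PolyRing k V)

/-- The comorphism of the projection `N(T) × V → V`. -/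
def inclVec : PolyRing k V →ₐ[k] ProdRing k V :=
  (Algebra.TensorProduct.includeRight : PolyRing k V →ₐ[k] CoordRing k ⊗[k] PolyRing k V)

/-- The product scheme `N(T) × V` is the spectrum of its coordinate ring. -/
def prodIso : pullback (groupStr k) (vecStr k V) ≅ Spec (.of (ProdRing k V)) :=
  pullbackSpecIso k (CoordRing k) (PolyRing k V)

lemma prodIso_hom_inclGroup :
    (prodIso k V).hom ≫ Spec.map (CommRingCat.ofHom (inclGroup k V).toRingHom) =
      pullback.fst _ _ :=
  pullbackSpecIso_hom_fst k (CoordRing k) (PolyRing k V)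

lemma prodIso_hom_inclVec :
    (prodIso k V).hom ≫ Spec.map (CommRingCat.ofHom (inclVec k V).toRingHom) =
      pullback.snd _ _ :=
  pullbackSpecIso_hom_snd k (CoordRing k) (PolyRing k V)

end Product

/-! ### Representations of `N(T)` and their action maps -/

/-- A (`k`-rational) representation of the group scheme `N(T)` on `V`: a linear action of the group
`N(T)(R)` on `R ⊗ V` for every `k`-algebra `R`, natural in `R`. -/
structure AlgRep (k : Type u) [Field k] (V : Type u) [AddCommGroup V] [Module k V] where
  /-- The action on `R`-points. -/
  act (R : Type u) [CommRing R] [Algebra k R] : Representation R (normalizer R) (R ⊗[k] V)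
  /-- The action is natural in `R`. -/
  natural (R S : Type u) [CommRing R] [Algebra k R] [CommRing S] [Algebra k S] (f : R →ₐ[k] S)
    (g : normalizer R) (x : R ⊗[k] V) :
    act S (normalizerMap (f : R →+* S) g) (f.toLinearMap.rTensor V x) =
      f.toLinearMap.rTensor V (act R g x)

namespace AlgRep

variable {k : Type u} [Field k] {V : Type u} [AddCommGroup V] [Module k V] (ρ : AlgRep k V)

/-- A linear subspace `L` of `V` is `N(T)`-invariant if `N(T)(R)` preserves `R ⊗ L` for every
`k`-algebra `R`. -/
def IsInvariantSubspace (L : Submodule k V) : Prop :=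
  ∀ (R : Type u) [CommRing R] [Algebra k R] (g : normalizer R), ∀ x ∈ L.baseChange R,
    ρ.act R g x ∈ L.baseChange R

variable [FiniteDimensional k V]

/-- The comorphism `k[V] → k[N(T)] ⊗ k[V]` of the action map: it is the point `g · v`, where `g` and
`v` are the universal points of `N(T)` and of `V`. -/
def coaction : PolyRing k V →ₐ[k] ProdRing k V :=
  vecPoint (ρ.act (ProdRing k V)
    (normalizerMap (inclGroup k V : CoordRing k →+* ProdRing k V) (universalElement k))
    ((inclVec k V).toLinearMap.rTensor V (universalVector k V)))

/-- On `R`-valued points the comorphism induces `(g, v) ↦ g · v`. -/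
theorem comp_coaction {R : Type u} [CommRing R] [Algebra k R]
    (f : ProdRing k V →ₐ[k] R) (g : normalizer R) (x : R ⊗[k] V)
    (hg : normalizerMap (f.comp (inclGroup k V) : CoordRing k →+* R) (universalElement k) = g)
    (hx : (f.comp (inclVec k V)).toLinearMap.rTensor V (universalVector k V) = x) :
    f.comp ρ.coaction = vecPoint (ρ.act R g x) := by
  subst hg hx
  refine SymmetricAlgebra.algHom_ext (LinearMap.ext fun φ => ?_)
  change f (vecPoint _ (SymmetricAlgebra.ι k _ φ)) = vecPoint _ (SymmetricAlgebra.ι k _ φ)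
  rw [vecPoint_ι, vecPoint_ι, ← baseChange_rTensor, ← ρ.natural, AlgHom.comp_toLinearMap,
    LinearMap.rTensor_comp]
  rfl

/-- The action map `N(T) × V → V`. -/
def actMap : pullback (groupStr k) (vecStr k V) ⟶ vecScheme k V :=
  (prodIso k V).hom ≫ Spec.map (CommRingCat.ofHom ρ.coaction.toRingHom)

lemma actMap_vecStr : ρ.actMap ≫ vecStr k V = pullback.snd _ _ ≫ vecStr k V := by
  have h : ρ.coaction.toRingHom.comp (algebraMap k (PolyRing k V)) =
      (inclGroup k V).toRingHom.comp (algebraMap k (CoordRing k)) :=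
    ρ.coaction.comp_algebraMap.trans (inclGroup k V).comp_algebraMap.symm
  have h1 : Spec.map (CommRingCat.ofHom ρ.coaction.toRingHom) ≫ vecStr k V =
      Spec.map (CommRingCat.ofHom (inclGroup k V).toRingHom) ≫ groupStr k := by
    unfold vecStr groupStr
    rw [← Spec.map_comp, ← Spec.map_comp, ← CommRingCat.ofHom_comp, ← CommRingCat.ofHom_comp, h]
  rw [← pullback.condition, ← prodIso_hom_inclGroup, actMap, Category.assoc, Category.assoc, h1]

/-- The structure morphism of an open subscheme of the affine space `V`. -/
def openStr (U : (vecScheme k V).Opens) : (U : Scheme.{u}) ⟶ Spec (.of k) := U.ι ≫ vecStr k V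

/-- The action map restricted to `N(T) × U`, as a morphism `N(T) × U → V`. -/
def actMapOn (U : (vecScheme k V).Opens) : pullback (groupStr k) (openStr U) ⟶ vecScheme k V :=
  pullback.lift (pullback.fst _ _) (pullback.snd _ _ ≫ U.ι)
    (by rw [Category.assoc]; exact pullback.condition) ≫ ρ.actMap

/-- An open subset `U` of `V` is `N(T)`-invariant if the action maps `N(T) × U` into `U`. -/
def IsInvariantOpen (U : (vecScheme k V).Opens) : Prop :=
  Set.range (ρ.actMapOn U) ⊆ Set.range U.ι

/-- The action map `N(T) × U → U` of an invariant open subset. -/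
def actMapTo (U : (vecScheme k V).Opens) (hU : ρ.IsInvariantOpen U) :
    pullback (groupStr k) (openStr U) ⟶ (U : Scheme.{u}) :=
  IsOpenImmersion.lift U.ι (ρ.actMapOn U) hU

/-- The map `N(T) × U → U × U`, `(g, v) ↦ (v, g · v)`, of an invariant open subset. -/
def shearMap (U : (vecScheme k V).Opens) (hU : ρ.IsInvariantOpen U) :
    pullback (groupStr k) (openStr U) ⟶ pullback (openStr U) (openStr U) :=
  pullback.lift (pullback.snd _ _) (ρ.actMapTo U hU) (by
    simp only [openStr, actMapTo, IsOpenImmersion.lift_fac_assoc, actMapOn, Category.assoc,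
      actMap_vecStr, pullback.lift_snd_assoc])

/-- The group acts properly on the invariant open subset `U` if `N(T) × U → U × U` is a proper
morphism of schemes. -/
def ActsProperlyOn (U : (vecScheme k V).Opens) (hU : ρ.IsInvariantOpen U) : Prop :=
  IsProper (ρ.shearMap U hU)

lemma mem_baseChange_iff (L : Submodule k V) (R : Type u) [CommRing R] [Algebra k R] (x : R ⊗[k] V) :
    x ∈ L.baseChange R ↔ ∀ φ ∈ L.dualAnnihilator, Module.Dual.baseChange R φ x = 0 := by
  constructor
  · intro hx φ hφ
    rw [Submodule.baseChange_eq_span] at hx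
    induction hx using Submodule.span_induction with
    | mem y hy =>
      obtain ⟨v, hv, rfl⟩ := hy
      have : φ v = 0 := (Submodule.mem_dualAnnihilator φ).1 hφ v hv
      simp [this]
    | zero => simp
    | add y z _ _ hy hz => simp [hy, hz]
    | smul r y _ hy => simp [hy]
  · intro h
    have hex := lTensor_exact R (LinearMap.exact_subtype_mkQ L) L.mkQ_surjective
    have h0 : L.mkQ.lTensor R x = 0 := by
      let b := Module.finBasis k (V ⧸ L)
      let c := Algebra.TensorProduct.basis R b
      refine c.ext_elem fun i => ?_
      have h1 := h (b.coord i ∘ₗ L.mkQ) ((Submodule.mem_dualAnnihilator _).2 fun v hv => by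
        simp [(Submodule.Quotient.mk_eq_zero L).2 hv])
      rw [map_zero, Finsupp.zero_apply, ← h1]
      clear h h1 hex
      induction x with
      | zero => simp
      | add y z hy hz => simp only [map_add, Finsupp.add_apply, hy, hz]
      | tmul r v => simp [c, Algebra.smul_def, mul_comm]
    obtain ⟨y, hy⟩ := (hex x).1 h0
    rw [← hy]
    clear hy h0 h
    induction y with
    | zero => simp
    | add y z hy hz => rw [map_add]; exact add_mem hy hz
    | tmul r v => exact Submodule.tmul_mem_baseChange_of_mem r v.2

/-- The complement of finitely many (or of any number of) invariant linear subspaces is automatically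
invariant, so the invariance of `U` in the definition of a good representation is no restriction. -/
theorem isInvariantOpen_of_compl (U : (vecScheme k V).Opens) (S : Set (Submodule k V))
    (hS : ∀ L ∈ S, ρ.IsInvariantSubspace L)
    (hU : (U : Set (vecScheme k V))ᶜ = ⋃ L ∈ S, subspaceLocus L) : ρ.IsInvariantOpen U := by
  rintro _ ⟨z, rfl⟩
  rw [Scheme.Opens.range_ι]
  by_contra hz
  have hz' : ρ.actMapOn U z ∈ (U : Set (vecScheme k V))ᶜ := hz
  rw [hU] at hz'
  simp only [Set.mem_iUnion] at hz'
  obtain ⟨L, hL, hzL⟩ := hz'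
  set y : ↥(pullback (groupStr k) (vecStr k V)) :=
    (pullback.lift (pullback.fst _ _) (pullback.snd _ _ ≫ U.ι) (by rw [Category.assoc]; exact pullback.condition) : pullback (groupStr k) (openStr U) ⟶ _) z with hy
  have hyU : pullback.snd (groupStr k) (vecStr k V) y ∈ U := by
    rw [hy, ← Scheme.Hom.comp_apply, pullback.lift_snd, Scheme.Hom.comp_apply]
    exact (pullback.snd (groupStr k) (openStr U) z).2
  have hyL : ρ.actMap y ∈ subspaceLocus L := by
    rw [hy, ← Scheme.Hom.comp_apply]; exact hzL
  set p : PrimeSpectrum (ProdRing k V) := (prodIso k V).hom y with hp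
  have hyL' : ∀ φ ∈ L.dualAnnihilator, ρ.coaction (SymmetricAlgebra.ι k _ φ) ∈ p.asIdeal := by
    intro φ hφ
    rw [actMap, Scheme.Hom.comp_apply] at hyL
    exact hyL ⟨φ, hφ, rfl⟩
  let f := Ideal.Quotient.mkₐ k p.asIdeal
  have hf := ρ.comp_coaction f _ _ rfl rfl
  have hv : ∀ φ ∈ L.dualAnnihilator, Module.Dual.baseChange (ProdRing k V ⧸ p.asIdeal) φ
      (ρ.act _ (normalizerMap (f.comp (inclGroup k V) : CoordRing k →+* _) (universalElement k))
        ((f.comp (inclVec k V)).toLinearMap.rTensor V (universalVector k V))) = 0 := by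
    intro φ hφ
    rw [← vecPoint_ι, ← hf]
    exact Ideal.Quotient.eq_zero_iff_mem.2 (hyL' φ hφ)
  have hmem := (mem_baseChange_iff L _ _).2 hv
  have hmem2 := hS L hL _
    (normalizerMap (f.comp (inclGroup k V) : CoordRing k →+* _) (universalElement k))⁻¹ _ hmem
  rw [← Module.End.mul_apply, ← map_mul, inv_mul_cancel, map_one, Module.End.one_apply] at hmem2
  have : pullback.snd (groupStr k) (vecStr k V) y ∈ (U : Set (vecScheme k V))ᶜ := by
    rw [hU]
    refine Set.mem_biUnion hL ?_
    rw [← prodIso_hom_inclVec, Scheme.Hom.comp_apply]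
    rintro _ ⟨φ, hφ, rfl⟩
    have h2 := (mem_baseChange_iff L _ _).1 hmem2 φ hφ
    rw [baseChange_rTensor, baseChange_universalVector] at h2
    have h3 : inclVec k V (SymmetricAlgebra.ι k _ φ) ∈ p.asIdeal := Ideal.Quotient.eq_zero_iff_mem.1 h2
    exact h3
  exact this hyU

/-- A representation `V` is good if there is a non-empty invariant open subset `U` of `V` on which
the group acts properly and whose complement is the union of finitely many invariant linear
subspaces. -/
def IsGood : Prop :=
  ∃ (U : (vecScheme k V).Opens) (hU : ρ.IsInvariantOpen U),
    (U : Set (vecScheme k V)).Nonempty ∧ ρ.ActsProperlyOn U hU ∧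
    ∃ S : Set (Submodule k V), S.Finite ∧ (∀ L ∈ S, ρ.IsInvariantSubspace L) ∧
      (U : Set (vecScheme k V))ᶜ = ⋃ L ∈ S, subspaceLocus L

end AlgRep

end NormalizerTorus

end

/-! The torus `T` splits `V` into weight spaces `V_n`, and the Weyl element exchanges `V_n` with
`V_{-n}`. Hence an invariant subspace containing all `V_n` with `n ≥ 0`, or all with `n ≤ 0`, is `V`
(`IsInvariantSubspace.eq_top`). The invariant subspaces that make up the complement of a non-empty
`U` are proper, so over an infinite field a generic `v = ∑ v_n` has both its half `∑_{n ≥ 0} v_n`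
and its half `∑_{n ≤ 0} v_n` in `U` (`exists_generic`).

Over `F[[π]]` put `x = ∑ π^{max(-n,0)} v_n` and `y = ∑ π^{max(n,0)} v_n`. Their reductions modulo
`π` are these two halves, so `x` and `y` are integral points of `U` (`range_vecPointMap_subset`).
Over the fraction field `diag(π, π⁻¹)` carries `x` to `y`. If the action were proper, the valuative
criterion would make this group element integral (`ActsProperlyOn.exists_integral`), but `π⁻¹` is
not a power series. Only the torus and one Weyl representative are used, so the characteristic plays
no role. -/

noncomputable section

namespace NormalizerTorus

/-! ### The torus, the Weyl element, and one-parameter points -/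

section Elements

variable {R S : Type u} [CommRing R] [CommRing S]

/-- The point `diag(s, s⁻¹)` of the torus, as a point of `N(T)`. -/
def torusElement (s : Rˣ) : normalizer R :=
  ⟨⟨!![(s : R), 0; 0, ((s⁻¹ : Rˣ) : R)], by simp [Matrix.det_fin_two_of]⟩,
    (mem_normalizer_iff _).2 ⟨by simp, by simp⟩⟩

/-- The point `(0, 1; -1, 0)` of `N(T)`. -/
def weylElement (R : Type u) [CommRing R] : normalizer R :=
  ⟨⟨!![0, 1; -1, 0], by simp [Matrix.det_fin_two_of]⟩,
    (mem_normalizer_iff _).2 ⟨by simp, by simp⟩⟩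

lemma normalizer_ext {g h : normalizer R}
    (H : ((g : SL(2, R)) : Matrix (Fin 2) (Fin 2) R) = (h : SL(2, R))) : g = h :=
  Subtype.ext (Subtype.ext H)

lemma torusElement_mul (s t : Rˣ) : torusElement (s * t) = torusElement s * torusElement t := by
  refine normalizer_ext (Eq.trans ?_ (Matrix.SpecialLinearGroup.coe_mul _ _).symm)
  simp [torusElement, mul_comm]

lemma torusElement_one : torusElement (1 : Rˣ) = 1 := by
  refine normalizer_ext ?_
  simp [torusElement, Matrix.one_fin_two]

/-- This relation is what makes the Weyl element negate weights. -/
lemma weylElement_mul_torusElement (s : Rˣ) :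
    weylElement R * torusElement s = torusElement s⁻¹ * weylElement R := by
  refine normalizer_ext ((Matrix.SpecialLinearGroup.coe_mul _ _).trans
    (Eq.trans ?_ (Matrix.SpecialLinearGroup.coe_mul _ _).symm))
  simp [torusElement, weylElement]

lemma normalizerMap_torusElement (f : R →+* S) (s : Rˣ) :
    normalizerMap f (torusElement s) = torusElement (Units.map (f : R →* S) s) := by
  refine normalizer_ext ?_
  ext i j
  change f ((torusElement s : SL(2, R)) i j) = _
  fin_cases i <;> fin_cases j <;> simp [torusElement]

lemma normalizerMap_weylElement (f : R →+* S) :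
    normalizerMap f (weylElement R) = weylElement S := by
  refine normalizer_ext ?_
  ext i j
  change f ((weylElement R : SL(2, R)) i j) = _
  fin_cases i <;> fin_cases j <;> simp [weylElement]

end Elements

/-! ### Laurent polynomials as the coordinate ring of the torus. -/

section Laurent

variable (k : Type u) [Field k]

/-- The variable of the Laurent polynomial ring, as a unit. -/
def laurentUnit : (LaurentPolynomial k)ˣ where
  val := LaurentPolynomial.T 1
  inv := LaurentPolynomial.T (-1)
  val_inv := by rw [← LaurentPolynomial.T_add]; simp
  inv_val := by rw [← LaurentPolynomial.T_add]; simp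

variable {k} {R : Type u} [CommRing R] [Algebra k R]

/-- Evaluation of Laurent polynomials at a unit, as an algebra map. -/
def laurentEval (s : Rˣ) : LaurentPolynomial k →ₐ[k] R :=
  AddMonoidAlgebra.lift k R ℤ ((Units.coeHom R).comp (zpowersHom Rˣ s))

lemma laurentEval_T (s : Rˣ) (n : ℤ) :
    laurentEval (k := k) s (LaurentPolynomial.T n) = ((s ^ n : Rˣ) : R) := by
  rw [laurentEval, LaurentPolynomial.T, AddMonoidAlgebra.lift_single]
  simp

/-- Every unit is a specialization of the universal unit `T`, so by naturality one action, over the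
Laurent polynomial ring, determines the whole torus action. -/
lemma map_laurentEval_laurentUnit (s : Rˣ) :
    Units.map ((laurentEval (k := k) s : LaurentPolynomial k →+* R) : _ →* R) (laurentUnit k) = s := by
  ext
  simp [laurentUnit, laurentEval_T]

end Laurent

namespace AlgRep

variable {k : Type u} [Field k] {V : Type u} [AddCommGroup V] [Module k V] (ρ : AlgRep k V)

/-! ### The Weyl element -/


/-- The action of the Weyl element on `V`. -/
def weylMap : V →ₗ[k] V :=
  (TensorProduct.lid k V).toLinearMap ∘ₗ ρ.act k (weylElement k) ∘ₗ TensorProduct.mk k k V 1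

/-- The Weyl element is already defined over `k`, so naturality along `k → R` applies. -/
lemma act_weylElement {R : Type u} [CommRing R] [Algebra k R] (v : V) :
    ρ.act R (weylElement R) (1 ⊗ₜ v) = 1 ⊗ₜ ρ.weylMap v := by
  have h := ρ.natural k R (Algebra.ofId k R) (weylElement k) (1 ⊗ₜ v)
  rw [normalizerMap_weylElement] at h
  have h2 : ρ.act k (weylElement k) (1 ⊗ₜ v) = 1 ⊗ₜ ρ.weylMap v := by
    apply (TensorProduct.lid k V).injective
    simp [weylMap]
  rw [h2] at h
  simpa using h

lemma weylMap_surjective : Function.Surjective ρ.weylMap := by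
  intro v
  refine ⟨TensorProduct.lid k V (ρ.act k (weylElement k)⁻¹ (1 ⊗ₜ v)), ?_⟩
  have h : ρ.act k (weylElement k) (ρ.act k (weylElement k)⁻¹ (1 ⊗ₜ v)) = 1 ⊗ₜ v := by
    rw [← Module.End.mul_apply, ← map_mul, mul_inv_cancel, map_one, Module.End.one_apply]
  have h1 : (1 : k) ⊗ₜ[k] TensorProduct.lid k V (ρ.act k (weylElement k)⁻¹ (1 ⊗ₜ v)) =
      ρ.act k (weylElement k)⁻¹ (1 ⊗ₜ v) := by
    apply (TensorProduct.lid k V).injective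
    simp
  rw [← h1, act_weylElement] at h
  simpa using congrArg (TensorProduct.lid k V) h

/-! ### Weight projections -/

/-- The projection of `V` onto its weight space of weight `n`. -/
def weightProj (n : ℤ) : V →ₗ[k] V :=
  Finsupp.lapply n ∘ₗ
    (TensorProduct.equivFinsuppOfBasisLeft (N := V) (AddMonoidAlgebra.basis ℤ k)).toLinearMap ∘ₗ
    (ρ.act (LaurentPolynomial k) (torusElement (laurentUnit k))).restrictScalars k ∘ₗ
    TensorProduct.mk k (LaurentPolynomial k) V 1

lemma weightProj_apply (n : ℤ) (v : V) :
    ρ.weightProj n v = TensorProduct.equivFinsuppOfBasisLeft (AddMonoidAlgebra.basis ℤ k)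
      (ρ.act (LaurentPolynomial k) (torusElement (laurentUnit k)) (1 ⊗ₜ v)) n := rfl

variable [FiniteDimensional k V]

/-- A finite set containing all weights. -/
def weights : Finset ℤ :=
  Finset.univ.biUnion fun i => (TensorProduct.equivFinsuppOfBasisLeft (AddMonoidAlgebra.basis ℤ k)
    (ρ.act (LaurentPolynomial k) (torusElement (laurentUnit k))
      (1 ⊗ₜ Module.finBasis k V i))).support

lemma weightProj_eq_zero {n : ℤ} (hn : n ∉ ρ.weights) : ρ.weightProj n = 0 := by
  refine (Module.finBasis k V).ext fun i => ?_
  rw [weightProj_apply, LinearMap.zero_apply]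
  simp only [weights, Finset.mem_biUnion, Finset.mem_univ, true_and, not_exists] at hn
  exact Finsupp.notMem_support_iff.1 (hn i)

/-- The left side is a Laurent polynomial with coefficients in `V`, and these coefficients are the
weight projections by definition. Summing over the fixed finite set `weights` gives an index set
independent of `v`. -/
lemma act_laurentUnit (v : V) :
    ρ.act (LaurentPolynomial k) (torusElement (laurentUnit k)) (1 ⊗ₜ v) =
      ∑ n ∈ ρ.weights, LaurentPolynomial.T n ⊗ₜ ρ.weightProj n v := by
  set x := ρ.act (LaurentPolynomial k) (torusElement (laurentUnit k)) (1 ⊗ₜ v) with hx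
  let e := TensorProduct.equivFinsuppOfBasisLeft (N := V) (AddMonoidAlgebra.basis ℤ k)
  have h1 : x = e.symm (e x) := (e.symm_apply_apply x).symm
  rw [TensorProduct.equivFinsuppOfBasisLeft_symm_apply] at h1
  rw [h1]
  refine (Finsupp.sum_of_support_subset _ ?_ _ (by simp)).trans
    (Finset.sum_congr rfl fun n _ => ?_)
  · intro n hn
    by_contra hn'
    refine Finsupp.mem_support_iff.1 hn ?_
    change ρ.weightProj n v = 0
    rw [ρ.weightProj_eq_zero hn', LinearMap.zero_apply]
  · congr 1

/-! ### Scaling of weight spaces and the torus action over an arbitrary `k`-algebra. -/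

section

variable {R S : Type u} [CommRing R] [Algebra k R] [CommRing S] [Algebra k S]

/-- The endomorphism of `R ⊗ V` that is multiplication by `f n` on the weight space of weight `n`. -/
def weightScale (f : ℤ → R) : R ⊗[k] V →ₗ[R] R ⊗[k] V :=
  ∑ n ∈ ρ.weights, f n • (ρ.weightProj n).baseChange R

lemma weightScale_tmul (f : ℤ → R) (r : R) (v : V) :
    ρ.weightScale f (r ⊗ₜ v) = ∑ n ∈ ρ.weights, (f n * r) ⊗ₜ ρ.weightProj n v := by
  simp [weightScale, LinearMap.sum_apply, TensorProduct.smul_tmul']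

/-- Specialize the universal formula `act_laurentUnit` along `T ↦ s`. -/
lemma act_torusElement (s : Rˣ) :
    ρ.act R (torusElement s) = ρ.weightScale fun n => ((s ^ n : Rˣ) : R) := by
  refine TensorProduct.AlgebraTensorModule.curry_injective (LinearMap.ext_ring (LinearMap.ext fun v => ?_))
  change ρ.act R (torusElement s) (1 ⊗ₜ v) = ρ.weightScale _ (1 ⊗ₜ v)
  have h := ρ.natural _ R (laurentEval s) (torusElement (laurentUnit k)) (1 ⊗ₜ v)
  rw [normalizerMap_torusElement, map_laurentEval_laurentUnit, act_laurentUnit] at h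
  simp only [LinearMap.rTensor_tmul, map_sum, AlgHom.toLinearMap_apply, map_one,
    laurentEval_T] at h
  rw [h, weightScale_tmul]
  simp

lemma rTensor_weightScale (φ : R →ₐ[k] S) (f : ℤ → R) (x : R ⊗[k] V) :
    φ.toLinearMap.rTensor V (ρ.weightScale f x) =
      ρ.weightScale (fun n => φ (f n)) (φ.toLinearMap.rTensor V x) := by
  induction x with
  | zero => simp
  | add x y hx hy => simp only [map_add, hx, hy]
  | tmul r v => simp [weightScale_tmul]

end

/-- The action is multiplicative: for two independent units `s`, `t`, compare the coefficients of
`s^m t^n` in `s · (t · v) = (st) · v`. The right side has only diagonal terms `(st)^n`. -/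
lemma weightProj_weightProj (m n : ℤ) (v : V) :
    ρ.weightProj m (ρ.weightProj n v) = if m = n then ρ.weightProj n v else 0 := by
  -- `B` is the ring of Laurent polynomials in `s` and `t`, with monomials indexed by `ℤ × ℤ`.
  let B := AddMonoidAlgebra k (ℤ × ℤ)
  let mon : Multiplicative (ℤ × ℤ) →* B := AddMonoidAlgebra.of k (ℤ × ℤ)
  let U : Multiplicative (ℤ × ℤ) →* Bˣ := mon.toHomUnits
  let s : Bˣ := U (.ofAdd (1, 0))
  let t : Bˣ := U (.ofAdd (0, 1))
  have hst : ∀ a b : ℤ, ((s ^ a : Bˣ) : B) * ((t ^ b : Bˣ) : B) = AddMonoidAlgebra.single (a, b) 1 := by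
    intro a b
    have : U (.ofAdd (a, b)) = s ^ a * t ^ b := by
      rw [← map_zpow U, ← map_zpow U, ← map_mul]
      congr 1
      apply Multiplicative.toAdd.injective
      simp
    rw [← Units.val_mul, ← this]
    rfl
  have hmul := ρ.act_torusElement (R := B) (s * t)
  rw [torusElement_mul, map_mul, act_torusElement, act_torusElement] at hmul
  have h := LinearMap.congr_fun hmul (1 ⊗ₜ v)
  simp only [Module.End.mul_apply, weightScale_tmul, map_sum, mul_one, mul_zpow, Units.val_mul, hst] at h
  have h2 := congrArg (fun x => TensorProduct.equivFinsuppOfBasisLeft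
    (AddMonoidAlgebra.basis (ℤ × ℤ) k) x (m, n)) h
  simp only [map_sum, Finsupp.finsetSum_apply,
    TensorProduct.equivFinsuppOfBasisLeft_apply_tmul_apply] at h2
  have hb : ∀ a b : ℤ × ℤ, (AddMonoidAlgebra.basis (ℤ × ℤ) k).repr (AddMonoidAlgebra.single a 1) b
      = if a = b then 1 else 0 := by
    intro a b
    simp [AddMonoidAlgebra.basis, Finsupp.single_apply]
  simp only [hb, Prod.mk.injEq, ite_smul, one_smul, zero_smul] at h2
  rw [Finset.sum_eq_single n, Finset.sum_eq_single m] at h2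
  · simp only [and_self, if_true] at h2
    rw [h2, Finset.sum_eq_single n]
    · by_cases hmn : m = n <;> simp [hmn, eq_comm]
    · intro b _ hb; simp [hb]
    · intro hn; simp [ρ.weightProj_eq_zero hn]
  · intro b _ hb; simp [hb]
  · intro hm; simp [ρ.weightProj_eq_zero hm]
  · intro b _ hb; exact Finset.sum_eq_zero fun i _ => by simp [hb]
  · intro hn; simp [ρ.weightProj_eq_zero hn]

lemma weightScale_weightProj {R : Type u} [CommRing R] [Algebra k R] (f : ℤ → R) (r : R) (n : ℤ)
    (v : V) : ρ.weightScale f (r ⊗ₜ ρ.weightProj n v) = (f n * r) ⊗ₜ ρ.weightProj n v := by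
  rw [weightScale_tmul, Finset.sum_eq_single n]
  · simp [weightProj_weightProj]
  · intro b _ hb; simp [weightProj_weightProj, hb]
  · intro hn; simp [ρ.weightProj_eq_zero hn]

lemma weightScale_weightScale {R : Type u} [CommRing R] [Algebra k R] (f g : ℤ → R)
    (x : R ⊗[k] V) : ρ.weightScale f (ρ.weightScale g x) = ρ.weightScale (fun n => f n * g n) x := by
  induction x with
  | zero => simp
  | add x y hx hy => simp only [map_add, hx, hy]
  | tmul r v =>
    rw [weightScale_tmul, weightScale_tmul, map_sum]
    simp [weightScale_weightProj, mul_assoc]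

/-- Specialization at `s = 1`, where the group acts trivially. -/
lemma sum_weightProj (v : V) : ∑ n ∈ ρ.weights, ρ.weightProj n v = v := by
  have h := LinearMap.congr_fun (ρ.act_torusElement (R := k) 1) (1 ⊗ₜ v)
  rw [torusElement_one, map_one, weightScale_tmul] at h
  simpa using congrArg (TensorProduct.lid k V) h.symm

/-- Apply both sides of `w t = t⁻¹ w` to `1 ⊗ v` for the universal `t` and compare the coefficients
of `T^n`. -/
lemma weylMap_weightProj (n : ℤ) (v : V) :
    ρ.weylMap (ρ.weightProj n v) = ρ.weightProj (-n) (ρ.weylMap v) := by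
  have h := congrArg (fun g => ρ.act (LaurentPolynomial k) g (1 ⊗ₜ v))
    (weylElement_mul_torusElement (laurentUnit k))
  simp only [map_mul, Module.End.mul_apply, act_weylElement, act_torusElement,
    weightScale_tmul, map_sum, mul_one] at h
  have hT : ∀ m : ℤ, ((laurentUnit k ^ m : (LaurentPolynomial k)ˣ) : LaurentPolynomial k) =
      AddMonoidAlgebra.single m 1 := by
    intro m
    have h1 : laurentUnit k = (AddMonoidAlgebra.of k ℤ).toHomUnits (.ofAdd 1) := Units.ext rfl
    rw [h1, ← map_zpow, ← Int.ofAdd_mul, one_mul]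
    rfl
  have hw : ∀ (r : LaurentPolynomial k) (u : V),
      ρ.act _ (weylElement _) (r ⊗ₜ u) = r ⊗ₜ ρ.weylMap u := by
    intro r u
    have : r ⊗ₜ[k] u = r • ((1 : LaurentPolynomial k) ⊗ₜ[k] u) := by
      simp [TensorProduct.smul_tmul']
    rw [this, map_smul, act_weylElement, TensorProduct.smul_tmul', smul_eq_mul, mul_one]
  simp only [hw, inv_zpow', hT] at h
  have h2 := congrArg (fun x => TensorProduct.equivFinsuppOfBasisLeft
    (AddMonoidAlgebra.basis ℤ k) x n) h
  have hb : ∀ a b : ℤ, (AddMonoidAlgebra.basis ℤ k).repr (AddMonoidAlgebra.single a 1) b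
      = if a = b then 1 else 0 := by
    intro a b
    simp [AddMonoidAlgebra.basis]
  simp only [map_sum, Finsupp.finsetSum_apply,
    TensorProduct.equivFinsuppOfBasisLeft_apply_tmul_apply] at h2
  simp only [hb, ite_smul, one_smul, zero_smul] at h2
  rw [Finset.sum_eq_single n, Finset.sum_eq_single (-n)] at h2
  · simpa using h2
  · intro b _ hb; rw [if_neg]; omega
  · intro hm; simp [ρ.weightProj_eq_zero hm]
  · intro b _ hb; simp [hb]
  · intro hn; simp [ρ.weightProj_eq_zero hn]

/-! ### Invariant subspaces -/

/-- `L` is cut out by the linear forms vanishing on it, and `k → R` is injective as `R` is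
nontrivial. -/
lemma one_tmul_mem_baseChange_iff (L : Submodule k V) {R : Type u} [CommRing R] [Nontrivial R]
    [Algebra k R] (v : V) : (1 : R) ⊗ₜ[k] v ∈ L.baseChange R ↔ v ∈ L := by
  refine ⟨fun h => ?_, fun h => Submodule.tmul_mem_baseChange_of_mem 1 h⟩
  rw [← Subspace.dualAnnihilator_dualCoannihilator_eq (W := L), Submodule.mem_dualCoannihilator]
  intro φ hφ
  have := (mem_baseChange_iff L R _).1 h φ hφ
  simpa [Algebra.algebraMap_eq_smul_one] using this

variable {ρ} in
lemma IsInvariantSubspace.weylMap_mem {L : Submodule k V} (hL : ρ.IsInvariantSubspace L) {v : V}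
    (hv : v ∈ L) : ρ.weylMap v ∈ L := by
  rw [← one_tmul_mem_baseChange_iff L (R := k), ← act_weylElement]
  exact hL k _ _ ((one_tmul_mem_baseChange_iff L v).2 hv)

variable {ρ} in
/-- An invariant subspace that contains one of any two opposite weight spaces is everything. -/
lemma IsInvariantSubspace.eq_top {L : Submodule k V} (hL : ρ.IsInvariantSubspace L)
    {R : Type u} [CommRing R] [Nontrivial R] [Algebra k R] (f : ℤ → R)
    (hf : ∀ n, f n = 1 ∨ f (-n) = 1) (h : ∀ x, ρ.weightScale f x ∈ L.baseChange R) : L = ⊤ := by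
  have h1 : ∀ n, f n = 1 → ∀ v, ρ.weightProj n v ∈ L := by
    intro n hn v
    have := h (1 ⊗ₜ ρ.weightProj n v)
    rw [weightScale_weightProj, hn, one_mul] at this
    exact (one_tmul_mem_baseChange_iff L _).1 this
  have h2 : ∀ n v, ρ.weightProj n v ∈ L := by
    intro n v
    rcases hf n with hn | hn
    · exact h1 n hn v
    -- Only the opposite weight space is known to lie in `L`; the Weyl element carries it onto this
    -- one.
    · obtain ⟨u, rfl⟩ := ρ.weylMap_surjective v
      rw [← neg_neg n, ← weylMap_weightProj]
      exact hL.weylMap_mem (h1 _ hn u)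
  refine (Submodule.eq_top_iff').2 fun v => ?_
  rw [← ρ.sum_weightProj v]
  exact sum_mem fun n _ => h2 n v

end AlgRep

/-! ### Points of the affine space `V` with values in a local ring -/

section Points

variable {k : Type u} [Field k] {V : Type u} [AddCommGroup V] [Module k V]
variable {R S : Type u} [CommRing R] [Algebra k R] [CommRing S] [Algebra k S]

/-- The `R`-valued point of the affine space `V` given by `x ∈ R ⊗ V`, as a morphism of schemes. -/
def vecPointMap (x : R ⊗[k] V) : Spec (.of R) ⟶ vecScheme k V :=
  Spec.map (CommRingCat.ofHom (vecPoint x).toRingHom)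

lemma comp_vecPoint (f : R →ₐ[k] S) (x : R ⊗[k] V) :
    f.comp (vecPoint x) = vecPoint (f.toLinearMap.rTensor V x) := by
  refine SymmetricAlgebra.algHom_ext (LinearMap.ext fun φ => ?_)
  change f (vecPoint x (SymmetricAlgebra.ι k _ φ)) = vecPoint _ (SymmetricAlgebra.ι k _ φ)
  rw [vecPoint_ι, vecPoint_ι, baseChange_rTensor]

lemma specMap_vecPointMap (f : R →ₐ[k] S) (x : R ⊗[k] V) :
    Spec.map (CommRingCat.ofHom f.toRingHom) ≫ vecPointMap x =
      vecPointMap (f.toLinearMap.rTensor V x) := by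
  rw [vecPointMap, vecPointMap, ← Spec.map_comp, ← CommRingCat.ofHom_comp, ← comp_vecPoint]
  rfl

lemma vecPointMap_vecStr (x : R ⊗[k] V) :
    vecPointMap x ≫ vecStr k V = Spec.map (CommRingCat.ofHom (algebraMap k R)) := by
  rw [vecPointMap, vecStr, ← Spec.map_comp, ← CommRingCat.ofHom_comp]
  congr 2
  exact (vecPoint x).comp_algebraMap

/-- A point with values in a local ring lies in an open subscheme as soon as its reduction avoids
the linear subspaces that make up the complement. -/
lemma range_vecPointMap_subset [FiniteDimensional k V] [IsLocalRing R] {F : Type u} [Field F]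
    [Algebra k F] (ε : R →ₐ[k] F) [IsLocalHom ε.toRingHom]
    (x : R ⊗[k] V) (U : (vecScheme k V).Opens) (T : Set (Submodule k V))
    (hU : (U : Set (vecScheme k V))ᶜ = ⋃ L ∈ T, subspaceLocus L)
    (hx : ∀ L ∈ T, ε.toLinearMap.rTensor V x ∉ L.baseChange F) :
    Set.range (vecPointMap x) ⊆ Set.range U.ι := by
  rw [Scheme.Opens.range_ι]
  rintro _ ⟨y, rfl⟩
  -- Every point of `Spec R` specializes to the closed point and open sets are stable under
  -- generization, so the closed point suffices.
  have hclosed : vecPointMap x (IsLocalRing.closedPoint R : PrimeSpectrum R) ∈ U := by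
    by_contra h
    have h' : vecPointMap x (IsLocalRing.closedPoint R : PrimeSpectrum R) ∈
      (U : Set (vecScheme k V))ᶜ := h
    rw [hU] at h'
    simp only [Set.mem_iUnion] at h'
    obtain ⟨L, hL, hxL⟩ := h'
    refine hx L hL ((AlgRep.mem_baseChange_iff L F _).2 fun φ hφ => ?_)
    rw [baseChange_rTensor, ← vecPoint_ι]
    have h2 : vecPoint x (SymmetricAlgebra.ι k _ φ) ∈ IsLocalRing.maximalIdeal R := hxL ⟨φ, hφ, rfl⟩
    by_contra h3
    exact (IsLocalRing.mem_maximalIdeal _).1 h2 (isUnit_of_map_unit ε.toRingHom _ (Ne.isUnit h3))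
  have hs : y ⤳ (IsLocalRing.closedPoint R : PrimeSpectrum R) := IsLocalRing.specializes_closedPoint y
  exact (hs.map (vecPointMap x).continuous).mem_open U.2 hclosed

/-- Needed to see that a non-empty `U` forces all removed subspaces to be proper. -/
lemma subspaceLocus_top : subspaceLocus (⊤ : Submodule k V) = Set.univ := by
  refine Set.eq_univ_of_forall fun p => ?_
  rintro _ ⟨φ, hφ, rfl⟩
  have : φ = 0 := by simpa using hφ
  simp [this]

end Points

/-! ### The valuative criterion for the shear map -/

namespace AlgRep

variable {k : Type u} [Field k] {V : Type u} [AddCommGroup V] [Module k V] (ρ : AlgRep k V)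
variable [FiniteDimensional k V]

/-- The morphism `(g, v) ↦ g · v` on points with values in a `k`-algebra. -/
lemma lift_actMap {K : Type u} [CommRing K] [Algebra k K] (γ : CoordRing k →ₐ[k] K) (x : K ⊗[k] V)
    (h : Spec.map (CommRingCat.ofHom γ.toRingHom) ≫ groupStr k = vecPointMap x ≫ vecStr k V) :
    pullback.lift (Spec.map (CommRingCat.ofHom γ.toRingHom)) (vecPointMap x) h ≫ ρ.actMap =
      vecPointMap (ρ.act K (normalizerMap (γ : CoordRing k →+* K) (universalElement k)) x) := by
  let f : ProdRing k V →ₐ[k] K := Algebra.TensorProduct.productMap γ (vecPoint x)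
  have h1 : f.comp (inclGroup k V) = γ := Algebra.TensorProduct.productMap_left γ (vecPoint x)
  have h2 : f.comp (inclVec k V) = vecPoint x := Algebra.TensorProduct.productMap_right γ (vecPoint x)
  have h3 := ρ.comp_coaction f _ x (by rw [h1]) (by rw [h2, rTensor_universalVector])
  have h4 : pullback.lift (Spec.map (CommRingCat.ofHom γ.toRingHom)) (vecPointMap x) h =
      Spec.map (CommRingCat.ofHom f.toRingHom) ≫ (prodIso k V).inv := by
    apply pullback.hom_ext
    · rw [pullback.lift_fst, ← prodIso_hom_inclGroup, Category.assoc, Iso.inv_hom_id_assoc,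
        ← Spec.map_comp, ← CommRingCat.ofHom_comp, ← h1]
      rfl
    · rw [pullback.lift_snd, ← prodIso_hom_inclVec, Category.assoc, Iso.inv_hom_id_assoc,
        ← Spec.map_comp, ← CommRingCat.ofHom_comp, vecPointMap, ← h2]
      rfl
  rw [h4, actMap, Category.assoc, Iso.inv_hom_id_assoc, ← Spec.map_comp, ← CommRingCat.ofHom_comp,
    vecPointMap, ← h3]
  rfl

lemma actMapTo_ι (U : (vecScheme k V).Opens) (hU : ρ.IsInvariantOpen U) :
    ρ.actMapTo U hU ≫ U.ι = ρ.actMapOn U :=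
  IsOpenImmersion.lift_fac _ _ _

lemma shearMap_fst (U : (vecScheme k V).Opens) (hU : ρ.IsInvariantOpen U) :
    ρ.shearMap U hU ≫ pullback.fst _ _ = pullback.snd _ _ :=
  pullback.lift_fst _ _ _

lemma shearMap_snd (U : (vecScheme k V).Opens) (hU : ρ.IsInvariantOpen U) :
    ρ.shearMap U hU ≫ pullback.snd _ _ = ρ.actMapTo U hU :=
  pullback.lift_snd _ _ _

/-- If the action on `U` is proper, then an element of the group over the fraction field of a
valuation ring that carries an integral point of `U` to an integral point of `U` is integral. -/
lemma ActsProperlyOn.exists_integral {ρ : AlgRep k V} {U : (vecScheme k V).Opens}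
    {hU : ρ.IsInvariantOpen U} (hp : ρ.ActsProperlyOn U hU)
    {R K : Type u} [CommRing R] [IsDomain R] [ValuationRing R] [Field K] [Algebra R K]
    [IsFractionRing R K] [Algebra k R] [Algebra k K] [IsScalarTower k R K]
    (x y : R ⊗[k] V) (hx : Set.range (vecPointMap x) ⊆ Set.range U.ι)
    (hy : Set.range (vecPointMap y) ⊆ Set.range U.ι) (g : normalizer K)
    (hg : ρ.act K g ((Algebra.algHom k R K).toLinearMap.rTensor V x) =
      (Algebra.algHom k R K).toLinearMap.rTensor V y) (i j : Fin 2) :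
    ∃ r : R, algebraMap R K r = (g : SL(2, K)) i j := by
  obtain ⟨γ, rfl⟩ := (universalElement_bijective k K).2 g
  let η : Spec (.of K) ⟶ Spec (.of R) := Spec.map (CommRingCat.ofHom (algebraMap R K))
  let a : Spec (.of R) ⟶ (U : Scheme.{u}) := IsOpenImmersion.lift U.ι (vecPointMap x) hx
  let b : Spec (.of R) ⟶ (U : Scheme.{u}) := IsOpenImmersion.lift U.ι (vecPointMap y) hy
  have ha : a ≫ U.ι = vecPointMap x := IsOpenImmersion.lift_fac _ _ _
  have hb : b ≫ U.ι = vecPointMap y := IsOpenImmersion.lift_fac _ _ _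
  have hηx := specMap_vecPointMap (Algebra.algHom k R K) x
  have hηy := specMap_vecPointMap (Algebra.algHom k R K) y
  change η ≫ _ = _ at hηx hηy
  have hγ : Spec.map (CommRingCat.ofHom γ.toRingHom) ≫ groupStr k =
      Spec.map (CommRingCat.ofHom (algebraMap k K)) := by
    rw [groupStr, ← Spec.map_comp, ← CommRingCat.ofHom_comp]
    congr 2
    exact γ.comp_algebraMap
  have hw : Spec.map (CommRingCat.ofHom γ.toRingHom) ≫ groupStr k = (η ≫ a) ≫ openStr U := by
    rw [openStr, Category.assoc, reassoc_of% ha, ← Category.assoc, hηx, vecPointMap_vecStr, hγ]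
  -- The valuative square: the `K`-point `(g, x)` of `N(T) × U` lies over the `R`-point `(x, y)` of
  -- `U × U`.
  let i₁ : Spec (.of K) ⟶ pullback (groupStr k) (openStr U) := pullback.lift _ _ hw
  have hab : a ≫ openStr U = b ≫ openStr U := by
    rw [openStr, reassoc_of% ha, reassoc_of% hb, vecPointMap_vecStr, vecPointMap_vecStr]
  let i₂ : Spec (.of R) ⟶ pullback (openStr U) (openStr U) := pullback.lift a b hab
  have hact : i₁ ≫ ρ.actMapTo U hU = η ≫ b := by
    rw [← cancel_mono U.ι, Category.assoc, Category.assoc, hb, hηy, ← hg, actMapTo_ι, actMapOn, ← Category.assoc, ← lift_actMap]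
    · congr 1
      apply pullback.hom_ext
      · rw [Category.assoc, pullback.lift_fst, pullback.lift_fst, pullback.lift_fst]
      · rw [Category.assoc, pullback.lift_snd, pullback.lift_snd, pullback.lift_snd_assoc,
          Category.assoc, ha, hηx]
    · rw [hγ, vecPointMap_vecStr]
  have hsq : CommSq i₁ η (ρ.shearMap U hU) i₂ := by
    refine ⟨?_⟩
    apply pullback.hom_ext
    · rw [Category.assoc, Category.assoc, shearMap_fst, pullback.lift_snd, pullback.lift_fst]
    · rw [Category.assoc, Category.assoc, shearMap_snd, pullback.lift_snd, hact]
  have hex : ValuativeCriterion.Existence (ρ.shearMap U hU) := by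
    have : IsProper (ρ.shearMap U hU) := hp
    have : UniversallyClosed (ρ.shearMap U hU) := inferInstance
    rw [UniversallyClosed.eq_valuativeCriterion] at this
    exact this.1
  obtain ⟨⟨l, hl, -⟩⟩ := (hex ⟨R, K, i₁, i₂, hsq⟩).exists_lift
  -- The group component of the lift is a ring map `k[N(T)] → R` extending `g`, so its values on the
  -- coordinate functions are the entries of `g`.
  obtain ⟨ψ, hψ⟩ := Spec.map_surjective (l ≫ pullback.fst _ _)
  have h1 : Spec.map (ψ ≫ CommRingCat.ofHom (algebraMap R K)) =
      Spec.map (CommRingCat.ofHom γ.toRingHom) := by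
    rw [Spec.map_comp, hψ, reassoc_of% hl, pullback.lift_fst]
  have h2 := Spec.map_injective h1
  refine ⟨ψ.hom (coordFn k i j), ?_⟩
  have h3 := congrArg (fun q => q.hom (coordFn k i j)) h2
  exact h3

/-! ### Generic vectors and the contradiction over power series. -/

/-- Generic vectors: over an infinite extension field there is a vector whose rescalings by `f` and
`g` avoid finitely many proper invariant subspaces. -/
lemma exists_generic {F : Type u} [Field F] [Infinite F] [Algebra k F] {T : Set (Submodule k V)}
    (hT : T.Finite) (hinv : ∀ L ∈ T, ρ.IsInvariantSubspace L) (htop : ⊤ ∉ T) (f g : ℤ → F)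
    (hf : ∀ n, f n = 1 ∨ f (-n) = 1) (hg : ∀ n, g n = 1 ∨ g (-n) = 1) :
    ∃ x : F ⊗[k] V, ∀ L ∈ T, ρ.weightScale f x ∉ L.baseChange F ∧
      ρ.weightScale g x ∉ L.baseChange F := by
  classical
  -- The bad vectors form a finite union of subspaces, all proper by `IsInvariantSubspace.eq_top`;
  -- over an infinite field such a union is not the whole space.
  let s : Finset (Subspace F (F ⊗[k] V)) :=
    hT.toFinset.image (fun L => (L.baseChange F).comap (ρ.weightScale f)) ∪
      hT.toFinset.image (fun L => (L.baseChange F).comap (ρ.weightScale g))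
  have hne : ∀ L ∈ T, ∀ h : ℤ → F, (∀ n, h n = 1 ∨ h (-n) = 1) →
      (L.baseChange F).comap (ρ.weightScale h) ≠ ⊤ := by
    intro L hL h hh htop'
    have : L = ⊤ := (hinv L hL).eq_top h hh fun x => by
      have : x ∈ (L.baseChange F).comap (ρ.weightScale h) := htop' ▸ Submodule.mem_top
      exact this
    exact htop (this ▸ hL)
  have hs : ⊤ ∉ s := by
    simp only [s, Finset.mem_union, Finset.mem_image, Set.Finite.mem_toFinset, not_or, not_exists,
      not_and]
    exact ⟨fun L hL => hne L hL f hf, fun L hL => hne L hL g hg⟩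
  have hcover := Subspace.biUnion_ne_univ_of_top_notMem hs
  obtain ⟨x, hx⟩ := (Set.ne_univ_iff_exists_notMem _).1 hcover
  simp only [Set.mem_iUnion, not_exists] at hx
  refine ⟨x, fun L hL => ⟨fun h => hx ((L.baseChange F).comap (ρ.weightScale f)) ?_ h,
    fun h => hx ((L.baseChange F).comap (ρ.weightScale g)) ?_ h⟩⟩
  · exact Finset.mem_union_left _ (Finset.mem_image_of_mem _ (hT.mem_toFinset.2 hL))
  · exact Finset.mem_union_right _ (Finset.mem_image_of_mem _ (hT.mem_toFinset.2 hL))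

lemma not_isGood : ¬ ρ.IsGood := by
  rintro ⟨U, hU, ⟨p, hpU⟩, hproper, T, hT, hinv, hcompl⟩
  have htop : ⊤ ∉ T := by
    intro h
    have : p ∈ (U : Set (vecScheme k V))ᶜ := by
      rw [hcompl]
      exact Set.mem_biUnion h (subspaceLocus_top (k := k) (V := V) ▸ Set.mem_univ p)
    exact this hpU
  -- Since `k` may be finite, an infinite extension is needed.
  let F := AlgebraicClosure k
  have : Infinite F := IsAlgClosed.instInfinite
  -- As `0 ^ 0 = 1`, the function `0 ^ n.toNat` is the indicator of `n ≤ 0`, and `0 ^ (-n).toNat`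
  -- that of `n ≥ 0`: these are the reductions of the powers of `π` below.
  have hzero : ∀ n : ℤ, (0 : F) ^ n.toNat = 1 ∨ (0 : F) ^ (-n).toNat = 1 := by
    intro n
    rcases le_total n 0 with h | h
    · left; rw [Int.toNat_of_nonpos h, pow_zero]
    · right; rw [Int.toNat_of_nonpos (by omega), pow_zero]
  obtain ⟨v, hv⟩ := ρ.exists_generic hT hinv htop (fun n => (0 : F) ^ (-n).toNat)
    (fun n => (0 : F) ^ n.toNat) (fun n => by simpa using (hzero n).symm) hzero
  let R := PowerSeries F
  let K := FractionRing R
  let C : F →ₐ[k] R := IsScalarTower.toAlgHom k F R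
  let ε : R →ₐ[k] F :=
    { (PowerSeries.constantCoeff (R := F)) with
      commutes' := fun c => PowerSeries.constantCoeff_C (algebraMap k F c) }
  have hεC : ε.toLinearMap.rTensor V (C.toLinearMap.rTensor V v) = v := by
    have : ε.comp C = AlgHom.id k F := by
      exact AlgHom.ext fun c => PowerSeries.constantCoeff_C c
    rw [← LinearMap.comp_apply, ← LinearMap.rTensor_comp, ← AlgHom.comp_toLinearMap, this]
    simp
  have : IsLocalHom ε.toRingHom := ⟨fun a ha => PowerSeries.isUnit_iff_constantCoeff.2 ha⟩
  have hεX : ε PowerSeries.X = 0 := PowerSeries.constantCoeff_X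
  let π : R := PowerSeries.X
  have hX : algebraMap R K π ≠ 0 := by
    rw [Ne, IsFractionRing.to_map_eq_zero_iff]
    exact PowerSeries.X_ne_zero
  let x := ρ.weightScale (fun n => π ^ (-n).toNat) (C.toLinearMap.rTensor V v)
  let y := ρ.weightScale (fun n => π ^ n.toNat) (C.toLinearMap.rTensor V v)
  have hx : Set.range (vecPointMap x) ⊆ Set.range U.ι := by
    refine range_vecPointMap_subset ε x U T hcompl fun L hL => ?_
    simp only [x, AlgRep.rTensor_weightScale, hεC, map_pow, π, hεX]
    exact (hv L hL).1
  have hy : Set.range (vecPointMap y) ⊆ Set.range U.ι := by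
    refine range_vecPointMap_subset ε y U T hcompl fun L hL => ?_
    simp only [y, AlgRep.rTensor_weightScale, hεC, map_pow, π, hεX]
    exact (hv L hL).2
  have hg : ρ.act K (torusElement (Units.mk0 _ hX))
      ((Algebra.algHom k R K).toLinearMap.rTensor V x) =
        (Algebra.algHom k R K).toLinearMap.rTensor V y := by
    simp only [x, y, AlgRep.rTensor_weightScale, AlgRep.act_torusElement,
      AlgRep.weightScale_weightScale]
    congr 2
    funext n
    simp only [Units.val_zpow_eq_zpow_val, Units.val_mk0, map_pow]
    change algebraMap R K π ^ n * algebraMap R K π ^ (-n).toNat = algebraMap R K π ^ n.toNat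
    -- The exponents agree because `n + max(-n,0) = max(n,0)`.
    rw [← zpow_natCast, ← zpow_natCast, ← zpow_add₀ hX]
    congr 1
    omega
  -- The lower right entry of the torus element is `π⁻¹`; its integrality would make `π` a unit of
  -- the power series ring.
  obtain ⟨r, hr⟩ := hproper.exists_integral x y hx hy _ hg 1 1
  have hr' : algebraMap R K (π * r) = 1 := by
    rw [map_mul, hr]
    simp [torusElement, hX]
  have h1 : π * r = 1 := by
    apply IsFractionRing.injective R K
    rw [hr', map_one]
  have h2 := congrArg ε h1
  rw [map_mul, hεX, zero_mul, map_one] at h2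
  exact zero_ne_one h2

end AlgRep

end NormalizerTorus

end

/-- The normalizer `N(T)` of the diagonal torus in `SL₂` has no good representation. -/
theorem theoremt {k : Type u} [Field k] {V : Type u} [AddCommGroup V] [Module k V]
    [FiniteDimensional k V] (ρ : NormalizerTorus.AlgRep k V) : ¬ ρ.IsGood :=
  ρ.not_isGood
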